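/- For a finite set $I$ let $\mathrm{NAP}(I)$ be the set of rooted trees with vertex set $I$. For rooted trees $t_1,\dots,t_k$ ($k\ge 0$) let $B(r,t_1,\dots,t_k)$ be the rooted tree obtained from their disjoint union by adding a new vertex $r$, which becomes the root, and an edge from $r$ to the root of each $t_i$. Let $\#\mathrm{Aut}(t)$ be the number of automorphisms of the rooted tree $t$. Let $\Pi(I)$ be the set of forests of rooted trees with vertex set $I$. If $x\in\Pi(I)$ and $\theta$ is a forest of rooted trees whose vertices are the components of $x$, let $\theta\circ x\in\Pi(I)$ be obtained from $x$ by joining, for each edge of $\theta$, the roots of the two corresponding components of $x$; its roots are the roots of those components of $x$ that are roots of $\theta$. Order $\Pi(I)$ by: $x\le y$ if and only if $y=\theta\circ x$ for some such $\theta$. Its least element $\widehat 0$ is the forest without edges. For an unlabelled rooted tree $\alpha$ (an isomorphism class of rooted trees) let $P_\alpha$ be the interval $[\widehat 0,t]$ in $\Pi(\{1,\dots,n\})$, where $t\in\mathrm{NAP}(\{1,\dots,n\})$ represents $\alpha$. The incidence Hopf algebra $H_{\mathrm{NAP}}$ is, as an algebra, the $\mathbb{Q}$-vector space with basis $\mathsf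 F_{[P]}$, where $[P]$ runs over the isomorphism classes of finite products $P$ of posets $P_\alpha$, with product $\mathsf F_{[P]}\mathsf F_{[Q]}=\mathsf F_{[P\times Q]}$. Write $\mathsf F_{[\alpha]}=\mathsf F_{[P_\alpha]}$. Let $G_{\mathrm{NAP}}$ be the group of formal series $f=\sum_t \mathsf G_t(f)\,t$ over unlabelled rooted trees $t$, with $\mathsf G_t(f)\in\mathbb{Q}$ and with coefficient $1$ at the one-vertex tree. The group $\operatorname{Spec}H_{\mathrm{NAP}}$ of $\mathbb{Q}$-algebra morphisms $\varphi:H_{\mathrm{NAP}}\to\mathbb{Q}$ is identified with its image in $G_{\mathrm{NAP}}$ under the embedding $$\varphi\longmapsto \sum_t \frac{\varphi(\mathsf F_{[t]})}{\#\mathrm{Aut}(t)}\,t .$$ **Lemma.** A series $f=\sum_t \mathsf G_t(f)\,t$ in $G_{\mathrm{NAP}}$ lies in (the image of) $\operatorname{Spec}H_{\mathrm{NAP}}$ if and only if, for every $k\ge 0$ and all rooted trees $t_1,\dots,t_k$, $$\#\mathrm{Aut}(B(r,t_1,\dots,t_k))\;\mathsf G_{B(r,t_1,\dots,t_k)}(f)=\prod_{i=1}^k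 \#\mathrm{Aut}(B(r,t_i))\;\mathsf G_{B(r,t_i)}(f).$$ -/

import Mathlib

namespace NAP

/-- A forest of rooted trees with vertex set `I`, given by its parent function: `parent a = some b`
when `b` is the neighbour of `a` on the path from `a` to the root of its component, and
`parent a = none` when `a` is a root. Well-foundedness says that following parents from any vertex
reaches a root after finitely many steps. These are the elements of the species
`Π_NAP = Comm ∘ NAP` at `I`: the parts of the underlying partition are the components. -/
@[ext]
structure Forest (I : Type) where
  parent : I → Option I
  wf : WellFounded (fun a b => parent b = some a)

/-- A rooted tree with vertex set `I` (an element of `NAP(I)`): a forest with exactly one root. -/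
@[ext]
structure Tree (I : Type) extends Forest I where
  existsUnique_root : ∃! r, parent r = none

namespace Forest

variable {I : Type}

/-- The roots of a forest. They index the parts of its underlying partition. -/
abbrev Roots (x : Forest I) : Type := {a : I // x.parent a = none}

/-- Operadic composition of a forest `θ` on the set of parts of `x` with the components of `x`: take
all components of `x`, and for each edge of `θ` join the roots of the two corresponding components.
The roots of the result are those of the components of `x` which are roots of `θ`. -/
def comp (x : Forest I) (θ : Forest x.Roots) : Forest I where
  parent a := if h : x.parent a = none then (θ.parent ⟨a, h⟩).map Subtype.val else x.parent a
  wf := by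
    set R : I → I → Prop := fun a b =>
      (if h : x.parent b = none then (θ.parent ⟨b, h⟩).map Subtype.val else x.parent b) = some a
      with hR
    have h1 : ∀ p : x.Roots, Acc R p.1 := by
      intro p
      induction p using θ.wf.induction with
      | _ p ih =>
        refine Acc.intro _ fun b hb => ?_
        simp only [hR, p.2, dif_pos, Option.map_eq_some_iff] at hb
        obtain ⟨q, hq, rfl⟩ := hb
        exact ih q hq
    refine ⟨fun a => ?_⟩
    induction a using x.wf.induction with
    | _ a ih =>
      by_cases ha : x.parent a = none
      · exact h1 ⟨a, ha⟩
      · refine Acc.intro _ fun b hb => ih b ?_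
        simpa only [hR, ha, dif_neg, not_false_eq_true] using hb

/-- `x ≤ y` if and only if `y = θ ∘ x` for some forest `θ` on the set of parts of `x`. -/
instance : LE (Forest I) := ⟨fun x y => ∃ θ : Forest x.Roots, x.comp θ = y⟩

theorem le_iff {x y : Forest I} : x ≤ y ↔
    (∀ a b, x.parent a = some b → y.parent a = some b) ∧
    (∀ a b, x.parent a = none → y.parent a = some b → x.parent b = none) := by
  constructor
  · rintro ⟨θ, rfl⟩
    refine ⟨fun a b h => ?_, fun a b h h' => ?_⟩
    · simp [comp, h]
    · simp only [comp, h, dif_pos, Option.map_eq_some_iff] at h'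
      obtain ⟨q, -, rfl⟩ := h'
      exact q.2
  · rintro ⟨h1, h2⟩
    refine ⟨⟨fun p => (y.parent p.1).pmap (fun b hb => ⟨b, hb⟩) (fun b hb => h2 p.1 b p.2 hb),
      ?_⟩, ?_⟩
    · refine Subrelation.wf (r := InvImage (fun a b => y.parent b = some a) Subtype.val)
        ?_ (InvImage.wf _ y.wf)
      intro p q h
      simp only [Option.pmap_eq_some_iff] at h
      obtain ⟨b, -, hb, rfl⟩ := h
      exact hb
    · ext1
      funext a
      by_cases ha : x.parent a = none
      · simp only [comp, ha, dif_pos, Option.map_pmap]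
        simp
      · obtain ⟨b, hb⟩ := Option.ne_none_iff_exists'.1 ha
        simp [comp, hb, h1 a b hb]

instance : PartialOrder (Forest I) where
  le_refl x := le_iff.2 ⟨fun _ _ h => h, fun a b h h' => by simp [h] at h'⟩
  le_trans x y z hxy hyz := by
    rw [le_iff] at hxy hyz ⊢
    refine ⟨fun a b h => hyz.1 a b (hxy.1 a b h), fun a b h h' => ?_⟩
    cases hy : y.parent a with
    | none =>
      have hb := hyz.2 a b hy h'
      cases hx : x.parent b with
      | none => rfl
      | some c => simp [hxy.1 b c hx] at hb
    | some c =>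
      have := hyz.1 a c hy
      rw [h'] at this
      exact hxy.2 a b h (by rw [hy, ← this])
  le_antisymm x y hxy hyx := by
    rw [le_iff] at hxy hyx
    ext a b
    exact ⟨hxy.1 a b, hyx.1 a b⟩

/-- The minimal element `0̂`: every component is a single vertex. -/
instance : OrderBot (Forest I) where
  bot := ⟨fun _ => none, ⟨fun a => Acc.intro a fun _ h => by simp at h⟩⟩
  bot_le y := le_iff.2 ⟨fun a b h => by simp at h, fun a b _ _ => rfl⟩

end Forest

namespace Tree

variable {I J K : Type}

/-- Transport of a rooted tree along a bijection of vertex sets (functoriality of the species). -/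
def relabel (e : I ≃ J) (t : Tree I) : Tree J where
  parent j := (t.parent (e.symm j)).map e
  wf := by
    refine Subrelation.wf (r := InvImage (fun a b => t.parent b = some a) e.symm)
      ?_ (InvImage.wf _ t.wf)
    intro a b h
    simp only [Option.map_eq_some_iff] at h
    obtain ⟨c, hc, rfl⟩ := h
    simpa [InvImage] using hc
  existsUnique_root := by
    obtain ⟨r, hr, hu⟩ := t.existsUnique_root
    refine ⟨e r, by simpa using hr, fun j hj => ?_⟩
    simp only [Option.map_eq_none_iff] at hj
    rw [← hu _ hj, Equiv.apply_symm_apply]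

theorem relabel_refl (t : Tree I) : t.relabel (Equiv.refl I) = t := by
  ext a b
  simp [relabel]

theorem relabel_trans (e : I ≃ J) (e' : J ≃ K) (t : Tree I) :
    (t.relabel e).relabel e' = t.relabel (e.trans e') := by
  ext a b
  simp [relabel]

/-- `# Aut(t)`, the number of root-preserving automorphisms of `t`. -/
noncomputable def autCard (t : Tree I) : ℕ := Nat.card {e : Equiv.Perm I // t.relabel e = t}

/-- The tree with a single vertex. -/
def single : Tree (Fin 1) where
  parent _ := none
  wf := ⟨fun a => Acc.intro a fun _ h => by simp at h⟩
  existsUnique_root := ⟨0, rfl, fun _ _ => Subsingleton.elim _ _⟩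

/-- `B(r, t_1, …, t_k)`: add a new root `r = none` and an edge between it and the root of each
`t_i`. -/
def graft {k : ℕ} {V : Fin k → Type} (t : ∀ i, Tree (V i)) : Tree (Option (Σ i, V i)) where
  parent
    | none => none
    | some ⟨i, a⟩ => some (((t i).parent a).map (Sigma.mk i))
  wf := by
    have h0 : ∀ R : Option (Σ i, V i) → Option (Σ i, V i) → Prop,
        (∀ a, ¬ R a none) →
        (∀ a i b, R a (some ⟨i, b⟩) → a = ((t i).parent b).map (Sigma.mk i)) →
        WellFounded R := by
      intro R hn hs
      have hnone : Acc R none := Acc.intro _ fun a h => (hn a h).elim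
      refine ⟨fun v => ?_⟩
      rcases v with _ | ⟨i, a⟩
      · exact hnone
      · induction a using (t i).wf.induction with
        | _ a ih =>
          refine Acc.intro _ fun b hb => ?_
          rw [hs b i a hb]
          cases h : (t i).parent a with
          | none => exact hnone
          | some c => exact ih c h
    refine h0 _ (fun a h => ?_) (fun a i b h => ?_)
    · simp at h
    · exact (Option.some.inj h).symm
  existsUnique_root := by
    refine ⟨none, rfl, fun v hv => ?_⟩
    rcases v with _ | ⟨i, a⟩
    · rfl
    · simp at hv

end Tree

/-- Two labelled rooted trees are equivalent if one is a relabelling of the other. -/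
instance treeSetoid : Setoid (Σ n : ℕ, Tree (Fin n)) where
  r s t := ∃ e : Fin s.1 ≃ Fin t.1, s.2.relabel e = t.2
  iseqv :=
    { refl := fun t => ⟨Equiv.refl _, t.2.relabel_refl⟩
      symm := fun {s t} ⟨e, h⟩ => ⟨e.symm, by
        rw [← h, Tree.relabel_trans, Equiv.self_trans_symm, Tree.relabel_refl]⟩
      trans := fun {s t u} ⟨e, h⟩ ⟨e', h'⟩ => ⟨e.trans e', by
        rw [← Tree.relabel_trans, h, h']⟩ }

/-- The coinvariants of the species `NAP`, i.e. the unlabelled rooted trees. -/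
def UTree : Type := Quotient treeSetoid

/-- The unlabelled rooted tree underlying a rooted tree on a finite set of vertices. -/
noncomputable def Tree.cls {I : Type} [Finite I] (t : Tree I) : UTree :=
  Quotient.mk treeSetoid ⟨Nat.card I, t.relabel (Finite.equivFin I)⟩

namespace UTree

/-- A representative `r(α)` of a coinvariant `α`. -/
noncomputable def rep (α : UTree) : Σ n : ℕ, Tree (Fin n) := Quotient.out α

/-- `# Aut(α)`, computed on a representative. -/
noncomputable def autCard (α : UTree) : ℕ := α.rep.2.autCard

/-- The unit coinvariant `ε`: the tree with one vertex. -/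
noncomputable def unit : UTree := Tree.single.cls

/-- The poset `P_α`: the interval `[0̂, r(α)]` in the poset of forests on the vertices of `r(α)`. -/
abbrev Interval (α : UTree) : Type :=
  Set.Icc (⊥ : Forest (Fin α.rep.1)) α.rep.2.toForest

end UTree

/-- Isomorphism of posets. -/
instance posetSetoid : Setoid PartOrd.{0} where
  r X Y := Nonempty (X ≃o Y)
  iseqv :=
    { refl := fun X => ⟨OrderIso.refl X⟩
      symm := fun ⟨e⟩ => ⟨e.symm⟩
      trans := fun ⟨e⟩ ⟨e'⟩ => ⟨e.trans e'⟩ }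

/-- Isomorphism classes of posets. -/
def PosetClass : Type 1 := Quotient posetSetoid

/-- The isomorphism class of a poset. -/
def PosetClass.mk (P : Type) [PartialOrder P] : PosetClass := Quotient.mk posetSetoid (PartOrd.of P)

theorem PosetClass.mk_eq {P Q : Type} [PartialOrder P] [PartialOrder Q] (e : P ≃o Q) :
    PosetClass.mk P = PosetClass.mk Q :=
  Quotient.sound (s := posetSetoid) ⟨e⟩

/-- Isomorphism classes of posets form a commutative monoid under the direct product `P × Q`; the
unit is the class of the one-element poset. -/
instance : CommMonoid PosetClass where
  mul := Quotient.map₂ (fun X Y => PartOrd.of (X × Y))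
    (fun _ _ ⟨e⟩ _ _ ⟨e'⟩ =>
      ⟨{ toEquiv := Equiv.prodCongr e.toEquiv e'.toEquiv,
         map_rel_iff' := fun {a b} => by simp [Prod.le_def] }⟩)
  one := PosetClass.mk PUnit
  mul_assoc a b c := by
    induction a, b, c using Quotient.inductionOn₃ with
    | _ X Y Z => exact Quotient.sound (s := posetSetoid) ⟨OrderIso.prodAssoc X Y Z⟩
  mul_comm a b := by
    induction a, b using Quotient.inductionOn₂ with
    | _ X Y => exact Quotient.sound (s := posetSetoid) ⟨OrderIso.prodComm⟩
  one_mul a := by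
    induction a using Quotient.inductionOn with
    | _ X =>
      exact Quotient.sound (s := posetSetoid)
        ⟨{ toEquiv := Equiv.punitProd X, map_rel_iff' := fun {a b} => by simp [Prod.le_def] }⟩
  mul_one a := by
    induction a using Quotient.inductionOn with
    | _ X =>
      exact Quotient.sound (s := posetSetoid)
        ⟨{ toEquiv := Equiv.prodPUnit X, map_rel_iff' := fun {a b} => by simp [Prod.le_def] }⟩

/-- The isomorphism classes of finite products of the posets `P_α`. -/
def products : Submonoid PosetClass :=
  Submonoid.closure (Set.range fun α : UTree => PosetClass.mk α.Interval)

/-- The incidence Hopf algebra `H_NAP`, as an algebra: it has a basis indexed by isomorphism classes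
of finite products of the posets `P_α`, multiplied by direct product of posets. -/
abbrev H : Type 1 := MonoidAlgebra ℚ products

/-- The basis element `F_[α]` of `H_NAP` attached to the poset `P_α`. -/
noncomputable def F (α : UTree) : H :=
  MonoidAlgebra.of ℚ products
    ⟨PosetClass.mk α.Interval, Submonoid.subset_closure (Set.mem_range_self α)⟩

/-- `G_NAP`: the formal series `∑ G_t t` over unlabelled rooted trees with rational coefficients in
which the coefficient of the one-vertex tree is `1`. -/
structure G where
  coeff : UTree → ℚ
  coeff_unit : coeff UTree.unit = 1

theorem rep_unit : UTree.unit.rep.1 = 1 := by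
  have h : Quotient.mk treeSetoid UTree.unit.rep = UTree.unit := Quotient.out_eq _
  obtain ⟨e, -⟩ := Quotient.exact h
  have := Fintype.card_congr e
  simpa using this

theorem autCard_unit : UTree.unit.autCard = 1 := by
  have : Subsingleton (Fin UTree.unit.rep.1) := by rw [rep_unit]; infer_instance
  unfold UTree.autCard Tree.autCard
  have h2 : Subsingleton {e : Equiv.Perm (Fin UTree.unit.rep.1) //
      UTree.unit.rep.2.relabel e = UTree.unit.rep.2} := inferInstance
  have h3 : Nonempty {e : Equiv.Perm (Fin UTree.unit.rep.1) //
      UTree.unit.rep.2.relabel e = UTree.unit.rep.2} := ⟨⟨Equiv.refl _, Tree.relabel_refl _⟩⟩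
  exact Nat.card_unique

theorem F_unit : F UTree.unit = 1 := by
  have hs : Subsingleton (Fin UTree.unit.rep.1) := by rw [rep_unit]; infer_instance
  have hF : Subsingleton (Forest (Fin UTree.unit.rep.1)) := by
    have key : ∀ (x : Forest (Fin UTree.unit.rep.1)) a, x.parent a = none := by
      intro x a
      cases h : x.parent a with
      | none => rfl
      | some b =>
        rw [Subsingleton.elim b a] at h
        exact (x.wf.irrefl.irrefl a h).elim
    refine ⟨fun x y => ?_⟩
    ext1
    funext a
    rw [key x, key y]
  have e : UTree.unit.Interval ≃o PUnit.{1} :=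
    { toFun := fun _ => PUnit.unit
      invFun := fun _ => ⟨⊥, le_rfl, bot_le⟩
      left_inv := fun _ => Subsingleton.elim _ _
      right_inv := fun _ => rfl
      map_rel_iff' := fun {x y} => by
        simp [Subsingleton.elim x y] }
  have h1 : (⟨PosetClass.mk UTree.unit.Interval,
      Submonoid.subset_closure (Set.mem_range_self UTree.unit)⟩ : products) = 1 :=
    Subtype.ext (PosetClass.mk_eq e)
  rw [F, h1, map_one]

/-- The embedding of `Spec H_NAP` into `G_NAP`: a rational point `φ` of `Spec H_NAP`, i.e. a
`ℚ`-algebra morphism `H_NAP → ℚ`, is sent to the series with coefficients `φ(F_[t]) / # Aut(t)`. -/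
noncomputable def specToG (φ : H →ₐ[ℚ] ℚ) : G where
  coeff α := φ (F α) / α.autCard
  coeff_unit := by rw [F_unit, autCard_unit, map_one]; norm_num

/-- The subgroup `Spec H_NAP` of `G_NAP` (as a set of series). -/
def specH : Set G := Set.range specToG

end NAP

/-! A forest below a tree `t` arises by cutting edges of `t`, so it is determined by the set of
vertices that keep their parent. The order of `Forest` says exactly that this set of non-root
vertices is closed under descendants. Hence `P_t` is the lattice of lower sets of `t` minus its
root, children lying below parents (`Forest.intervalIso`).

Removing the root of `B(r, t_1, …, t_k)` leaves the disjoint union of the `t_i`, and lower sets of a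
disjoint union form a product. The factor of `t_i` is the poset of `B(r, t_i)`, so `F` is
multiplicative over graftings (`F_graft`). Applying `φ` gives the necessity of the equations.

For the converse, `H` must have no further relations. By Birkhoff duality the lattice `P_t`
determines `t` minus its root, hence `t` (`mk_interval_injective`). Every tree is a grafting, and
concatenating two grafted families realises the product of their posets (`exists_mul`). So the
classes of the `P_α` already form the whole monoid `products`, each for a unique `α`. The equations
make `α ↦ #Aut(α) G_α` a monoid morphism on it, which extends linearly to `H`. -/

namespace NAP

/-! ### Closed sets and Birkhoff duality -/

/-- The subsets that contain every `R`-predecessor of each of their elements, ordered by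
inclusion. -/
abbrev ClosedSet {X : Type} (R : X → X → Prop) : Type :=
  {S : Set X // ∀ a b, R a b → b ∈ S → a ∈ S}

namespace ClosedSet

/-- Isomorphic relations have isomorphic posets of closed sets. -/
def congr {X Y : Type} {R : X → X → Prop} {S : Y → Y → Prop} (e : R ≃r S) :
    ClosedSet R ≃o ClosedSet S where
  toFun A := ⟨e.symm ⁻¹' A.1, fun _ _ h hb => A.2 _ _ (e.symm.map_rel_iff.2 h) hb⟩
  invFun B := ⟨e ⁻¹' B.1, fun _ _ h hb => B.2 _ _ (e.map_rel_iff.2 h) hb⟩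
  left_inv A := by ext; simp
  right_inv B := by ext; simp
  map_rel_iff' := by
    intro A B
    refine ⟨fun h a ha => ?_, fun h a ha => h ha⟩
    have h1 : e.symm (e a) ∈ B.1 := h (show e.symm (e a) ∈ A.1 by simpa using ha)
    simpa using h1

/-- Closed sets of a disjoint union are families of closed sets of the summands. -/
def sigmaIso {k : ℕ} {V : Fin k → Type} (R : ∀ i, V i → V i → Prop)
    (S : (Σ i, V i) → (Σ i, V i) → Prop)
    (hS : ∀ a b, S a b ↔ ∃ c, R a.1 a.2 c ∧ Sigma.mk a.1 c = b) :
    ClosedSet S ≃o ∀ i, ClosedSet (R i) where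
  toFun A i := ⟨Sigma.mk i ⁻¹' A.1, fun a b h hb => A.2 ⟨i, a⟩ ⟨i, b⟩ ((hS _ _).2 ⟨b, h, rfl⟩) hb⟩
  invFun B := ⟨{a | a.2 ∈ (B a.1).1}, fun a b h hb => by
    obtain ⟨c, hc, rfl⟩ := (hS _ _).1 h
    exact (B a.1).2 _ _ hc hb⟩
  left_inv A := rfl
  right_inv B := rfl
  map_rel_iff' := by
    intro A B
    exact ⟨fun h a ha => h a.1 ha, fun h i a ha => h ha⟩

/-- The partial order generated by a well-founded relation. -/
abbrev generatedOrder {X : Type} (R : X → X → Prop) (wf : WellFounded fun a b => R b a) :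
    PartialOrder X where
  le := Relation.ReflTransGen R
  le_refl _ := Relation.ReflTransGen.refl
  le_trans _ _ _ := Relation.ReflTransGen.trans
  le_antisymm a b hab hba := by
    by_contra hne
    have h1 : Relation.TransGen R a b :=
      (Relation.reflTransGen_iff_eq_or_transGen.1 hab).resolve_left (Ne.symm hne)
    have h2 : Relation.TransGen (fun a b => R b a) a a :=
      Relation.transGen_swap.2 (h1.trans_left hba)
    exact wf.transGen.irrefl.irrefl a h2

/-- Functionality forces every chain of `R`-steps from `a` to begin with the same step, so nothing
fits strictly between. An order isomorphism preserves covers, hence it preserves `R` itself. -/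
theorem covBy_generatedOrder {X : Type} {R : X → X → Prop} (wf : WellFounded fun a b => R b a)
    (hR : ∀ a b c, R a b → R a c → b = c) (a b : X) :
    letI := generatedOrder R wf
    a ⋖ b ↔ R a b := by
  let := generatedOrder R wf
  have hlt : ∀ {x y}, R x y → x < y := fun {x y} h =>
    lt_of_le_of_ne (Relation.ReflTransGen.single h) (by rintro rfl; exact wf.irrefl.irrefl x h)
  constructor
  · intro h
    obtain h1 | ⟨c, hc, hcb⟩ := (show Relation.ReflTransGen R a b from h.le).cases_head
    · exact (h.ne h1).elim
    · obtain rfl | h2 := eq_or_lt_of_le (show c ≤ b from hcb)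
      · exact hc
      · exact (h.2 (hlt hc) h2).elim
  · intro h
    refine ⟨hlt h, fun c hac hcb => ?_⟩
    obtain h1 | ⟨d, hd, hdc⟩ := (show Relation.ReflTransGen R a c from hac.le).cases_head
    · exact hac.ne h1
    · obtain rfl := hR _ _ _ h hd
      exact hcb.not_ge hdc

/-- The closed sets of a well-founded relation are the lower sets of the generated order. -/
def lowerSetIso {X : Type} (R : X → X → Prop) (wf : WellFounded fun a b => R b a) :
    letI := generatedOrder R wf
    ClosedSet R ≃o LowerSet X :=
  letI := generatedOrder R wf
  { toFun := fun A => ⟨A.1, fun b a hab hb => by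
      induction (show Relation.ReflTransGen R a b from hab) using
        Relation.ReflTransGen.head_induction_on with
      | refl => exact hb
      | head h1 h2 ih => exact A.2 _ _ h1 (ih h2)⟩
    invFun := fun B => ⟨B, fun a b h hb => B.lower (Relation.ReflTransGen.single h) hb⟩
    left_inv := fun _ => rfl
    right_inv := fun _ => rfl
    map_rel_iff' := Iff.rfl }

theorem supIrred_orderIso {P Q : Type} [SemilatticeSup P] [SemilatticeSup Q] (e : P ≃o Q) {a : P}
    (h : SupIrred a) : SupIrred (e a) := by
  refine ⟨fun hm => h.1 fun b hb => ?_, fun b c hbc => ?_⟩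
  · exact e.le_iff_le.1 (hm (e.monotone hb))
  · have h1 : e.symm b ⊔ e.symm c = a := by rw [← map_sup, hbc, e.symm_apply_apply]
    exact (h.2 h1).imp (fun h => by rw [← h, e.apply_symm_apply])
      fun h => by rw [← h, e.apply_symm_apply]

/-- A finite poset is determined by its lattice of lower sets. -/
theorem nonempty_orderIso_of_lowerSet {X Y : Type} [PartialOrder X] [PartialOrder Y] [Finite X]
    [Finite Y] (e : LowerSet X ≃o LowerSet Y) : Nonempty (X ≃o Y) := by
  -- The sup-irreducible lower sets of a finite poset are the principal ones, so they form a copy of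
  -- the poset.
  have h : ∀ s, SupIrred s ↔ SupIrred (e s) := fun s =>
    ⟨supIrred_orderIso e, fun h => by simpa using supIrred_orderIso e.symm h⟩
  let e' : {s : LowerSet X // SupIrred s} ≃o {s : LowerSet Y // SupIrred s} :=
    { toEquiv := e.toEquiv.subtypeEquiv h
      map_rel_iff' := fun {a b} => e.le_iff_le (x := a.1) (y := b.1) }
  exact ⟨(OrderIso.supIrredLowerSet.trans e').trans OrderIso.supIrredLowerSet.symm⟩

/-- A finite well-founded functional relation is determined by its poset of closed sets. -/
theorem nonempty_relIso {X Y : Type} [Finite X] [Finite Y] {R : X → X → Prop} {S : Y → Y → Prop}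
    (wfR : WellFounded fun a b => R b a) (wfS : WellFounded fun a b => S b a)
    (hR : ∀ a b c, R a b → R a c → b = c) (hS : ∀ a b c, S a b → S a c → b = c)
    (e : ClosedSet R ≃o ClosedSet S) : Nonempty (R ≃r S) := by
  let := generatedOrder R wfR
  let := generatedOrder S wfS
  obtain ⟨g⟩ := nonempty_orderIso_of_lowerSet
    (((lowerSetIso R wfR).symm.trans e).trans (lowerSetIso S wfS))
  refine ⟨⟨g.toEquiv, fun {a b} => ?_⟩⟩
  rw [← covBy_generatedOrder wfR hR, ← covBy_generatedOrder wfS hS]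
  exact apply_covBy_apply_iff g

end ClosedSet

/-! ### Lower intervals, components and deletion of roots -/

namespace Forest

variable {I : Type}

theorem eq_of_parent {x : Forest I} {a b c : I} (h : x.parent a = some b)
    (h' : x.parent a = some c) : b = c :=
  Option.some.inj (h.symm.trans h')

/-- The vertices which are not roots. -/
abbrev NonRoot (x : Forest I) : Type := {a : I // x.parent a ≠ none}

/-- The relation between a non-root vertex and its parent, when the latter is not a root. -/
def ChildOf (x : Forest I) (a b : x.NonRoot) : Prop := x.parent a = some b.1

theorem childOf_wf (x : Forest I) : WellFounded fun a b => x.ChildOf b a :=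
  InvImage.wf Subtype.val x.wf

theorem childOf_functional (x : Forest I) (a b c : x.NonRoot) (h : x.ChildOf a b)
    (h' : x.ChildOf a c) : b = c :=
  Subtype.ext (eq_of_parent h h')

/-- The forest obtained by cutting the edges above the vertices outside a closed set. -/
noncomputable def cut (x : Forest I) (A : ClosedSet x.ChildOf) : Forest I := by
  classical
  exact
  { parent := fun a => if ∃ h, (⟨a, h⟩ : x.NonRoot) ∈ A.1 then x.parent a else none
    wf := by
      refine Subrelation.wf (fun {a b} h => ?_) x.wf
      split_ifs at h
      exact h }

/-- The lower interval of a forest is the poset of descendant-closed sets of non-root vertices. -/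
noncomputable def intervalIso (x : Forest I) :
    Set.Icc (⊥ : Forest I) x ≃o ClosedSet x.ChildOf :=
  RelIso.ofSurjective
    (OrderEmbedding.ofMapLEIff
      -- The second clause of `le_iff` for `y ≤ x` is precisely closure of this set under children.
      (fun y => (⟨{a | y.1.parent a ≠ none}, fun a b h hb ha =>
        hb ((le_iff.1 y.2.2).2 a b ha h)⟩ : ClosedSet x.ChildOf))
      (by
        rintro ⟨y, -, hy⟩ ⟨z, -, hz⟩
        rw [le_iff] at hy hz
        constructor
        · intro h
          refine le_iff.2 ⟨fun a b hab => ?_, fun a b hya hza => hy.2 a b hya (hz.1 a b hza)⟩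
          have hx := hy.1 a b hab
          have h1 : z.parent a ≠ none :=
            h (show (⟨a, by simp [hx]⟩ : x.NonRoot) ∈ {a : x.NonRoot | y.parent a ≠ none} from
              fun h0 => Option.some_ne_none b (hab.symm.trans h0))
          obtain ⟨c, hc⟩ := Option.ne_none_iff_exists'.1 h1
          rw [hc, eq_of_parent hx (hz.1 a c hc)]
        · intro h a ha
          obtain ⟨c, hc⟩ := Option.ne_none_iff_exists'.1 ha
          have := (le_iff.1 h).1 _ c hc
          exact fun h0 => Option.some_ne_none c (this.symm.trans h0)))
    (by
      intro A
      have hp : ∀ a, (∃ h, (⟨a, h⟩ : x.NonRoot) ∈ A.1) → (x.cut A).parent a = x.parent a :=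
        fun a h => by simp only [cut]; exact if_pos h
      have hn : ∀ a, (¬ ∃ h, (⟨a, h⟩ : x.NonRoot) ∈ A.1) → (x.cut A).parent a = none :=
        fun a h => by simp only [cut]; exact if_neg h
      refine ⟨⟨x.cut A, bot_le, le_iff.2 ⟨fun a b h => ?_, fun a b h h' => ?_⟩⟩, ?_⟩
      · by_cases h1 : ∃ h, (⟨a, h⟩ : x.NonRoot) ∈ A.1
        · rwa [hp a h1] at h
        · simp [hn a h1] at h
      · refine hn b ?_
        rintro ⟨hb, hbA⟩
        -- Here `a` is a child of `b` in `x`; if `b` kept its edge, closedness would make `a` keep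
        -- its own.
        have ha : x.parent a ≠ none := by simp [h']
        rw [hp a ⟨ha, A.2 ⟨a, ha⟩ ⟨b, hb⟩ h' hbA⟩] at h
        exact ha h
      · refine Subtype.ext (Set.ext fun a => ?_)
        change (x.cut A).parent a ≠ none ↔ a ∈ A.1
        by_cases h1 : a ∈ A.1
        · simp [hp a ⟨a.2, h1⟩, a.2, h1]
        · simp [hn a fun h => h1 h.2, h1])

/-- The root of the component of a vertex. -/
noncomputable def rootOf (x : Forest I) : I → x.Roots :=
  x.wf.fix fun a ih =>
    match h : x.parent a with
    | none => ⟨a, h⟩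
    | some b => ih b h

theorem rootOf_root (x : Forest I) (r : x.Roots) : x.rootOf r = r := by
  rw [rootOf, WellFounded.fix_eq]
  split
  · rfl
  · next b h => simp [r.2] at h

theorem rootOf_parent (x : Forest I) {a b : I} (hab : x.parent a = some b) :
    x.rootOf a = x.rootOf b := by
  rw [rootOf, WellFounded.fix_eq]
  split
  · next h => simp [h] at hab
  · next c h =>
    obtain rfl := eq_of_parent h hab
    rfl

/-- The component of a forest with a given root. -/
noncomputable def component (x : Forest I) (r : x.Roots) : Tree {a : I // x.rootOf a = r} where
  parent a := (x.parent a.1).pmap (fun b hb => ⟨b, hb⟩)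
    fun _ hb => (x.rootOf_parent hb).symm.trans a.2
  wf := by
    refine Subrelation.wf (r := InvImage (fun a b => x.parent b = some a) Subtype.val)
      ?_ (InvImage.wf _ x.wf)
    intro p q h
    simp only [Option.pmap_eq_some_iff] at h
    obtain ⟨b, -, hb, rfl⟩ := h
    exact hb
  existsUnique_root := by
    refine ⟨⟨r.1, x.rootOf_root r⟩, by simp [r.2], ?_⟩
    rintro ⟨a, rfl⟩ h
    have ha : x.parent a = none := by simpa using h
    exact Subtype.ext (congrArg Subtype.val (x.rootOf_root ⟨a, ha⟩)).symm

theorem component_parent (x : Forest I) (r : x.Roots) (a b : {a : I // x.rootOf a = r}) :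
    (x.component r).parent a = some b ↔ x.parent a.1 = some b.1 := by
  simp only [component, Option.pmap_eq_some_iff]
  constructor
  · rintro ⟨c, -, h, rfl⟩
    exact h
  · intro h
    exact ⟨b.1, b.2, h, rfl⟩

/-- The forest obtained by deleting the roots. -/
noncomputable def deleteRoots (x : Forest I) : Forest x.NonRoot := by
  classical
  exact
  { parent := fun a => (x.parent a.1).bind fun b =>
      if h : x.parent b ≠ none then some ⟨b, h⟩ else none
    wf := by
      refine Subrelation.wf (r := InvImage (fun a b => x.parent b = some a) Subtype.val)
        ?_ (InvImage.wf _ x.wf)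
      intro a b h
      simp only [Option.bind_eq_some_iff] at h
      obtain ⟨c, hc, h⟩ := h
      split_ifs at h
      obtain rfl := Option.some.inj h
      exact hc }

theorem deleteRoots_parent (x : Forest I) (a b : x.NonRoot) :
    x.deleteRoots.parent a = some b ↔ x.ChildOf a b := by
  simp only [deleteRoots, ChildOf, Option.bind_eq_some_iff]
  constructor
  · rintro ⟨c, hc, h⟩
    split_ifs at h
    obtain rfl := Option.some.inj h
    exact hc
  · intro h
    exact ⟨b.1, h, by simp [b.2]⟩

end Forest

/-! ### Reconstruction, relabelling and grafting of trees -/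

namespace Tree

variable {I J : Type}

theorem eq_of_roots (t : Tree I) {a b : I} (ha : t.parent a = none) (hb : t.parent b = none) :
    a = b :=
  t.existsUnique_root.unique ha hb

/-- A rooted tree is determined by the parent relation between its non-root vertices. -/
theorem exists_relabel_eq {s : Tree I} {t : Tree J}
    (e : s.toForest.ChildOf ≃r t.toForest.ChildOf) : ∃ f : I ≃ J, s.relabel f = t := by
  classical
  obtain ⟨r, hr, hr'⟩ := s.existsUnique_root
  obtain ⟨q, hq, hq'⟩ := t.existsUnique_root
  -- Outside the non-root vertices each tree has only its root, so `e` extends by matching the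
  -- roots.
  let d : {a // ¬ s.parent a ≠ none} ≃ {a // ¬ t.parent a ≠ none} :=
    { toFun := fun _ => ⟨q, by simpa using hq⟩
      invFun := fun _ => ⟨r, by simpa using hr⟩
      left_inv := fun a => Subtype.ext (hr' a.1 (by simpa using a.2)).symm
      right_inv := fun a => Subtype.ext (hq' a.1 (by simpa using a.2)).symm }
  let f : I ≃ J := (Equiv.sumCompl fun a => s.parent a ≠ none).symm.trans
    ((Equiv.sumCongr e.toEquiv d).trans (Equiv.sumCompl fun a => t.parent a ≠ none))
  have hf : ∀ a : s.toForest.NonRoot, f a.1 = (e a).1 := fun a => by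
    simp only [f, Equiv.trans_apply]
    rw [Equiv.sumCompl_symm_apply_of_pos (p := fun a => s.parent a ≠ none) a.2]
    rfl
  have hf0 : ∀ a, s.parent a = none → t.parent (f a) = none := fun a ha => by
    simp only [f, Equiv.trans_apply]
    rw [Equiv.sumCompl_symm_apply_of_neg (p := fun a => s.parent a ≠ none) (by simpa using ha)]
    exact hq
  have key : ∀ a, t.parent (f a) = (s.parent a).map f := by
    intro a
    cases ha : s.parent a with
    | none => simpa using hf0 a ha
    | some b =>
      have ha' : s.parent a ≠ none := by simp [ha]
      rw [hf ⟨a, ha'⟩]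
      by_cases hb : s.parent b = none
      · obtain ⟨c, hc⟩ := Option.ne_none_iff_exists'.1 (e ⟨a, ha'⟩).2
        by_cases hc' : t.parent c = none
        · rw [hc, Option.map_some, t.eq_of_roots hc' (hf0 b hb)]
        -- A non-root parent of `e a` would pull back along `e` to a non-root parent of `a`, but the
        -- parent of `a` is the root.
        · exfalso
          have h1 : s.toForest.ChildOf ⟨a, ha'⟩ (e.symm ⟨c, hc'⟩) :=
            e.map_rel_iff.1 (by rw [e.apply_symm_apply]; exact hc)
          have h2 := Forest.eq_of_parent h1 ha
          exact (e.symm ⟨c, hc'⟩).2 (h2 ▸ hb)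
      · rw [Option.map_some, hf ⟨b, hb⟩]
        exact e.map_rel_iff.2 (show s.toForest.ChildOf ⟨a, ha'⟩ ⟨b, hb⟩ from ha)
  refine ⟨f, ?_⟩
  ext1
  funext j
  obtain ⟨a, rfl⟩ := f.surjective j
  rw [key]
  simp [relabel]

theorem relabel_symm_relabel (t : Tree I) (e : I ≃ J) : (t.relabel e).relabel e.symm = t := by
  rw [relabel_trans, Equiv.self_trans_symm, relabel_refl]

theorem relabel_parent (t : Tree I) (e : I ≃ J) (a : I) :
    (t.relabel e).parent (e a) = (t.parent a).map e := by
  simp [relabel]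

/-- Relabelling does not change the parent relation between the non-root vertices. -/
def relabelChildOf (t : Tree I) (e : I ≃ J) :
    t.toForest.ChildOf ≃r (t.relabel e).toForest.ChildOf where
  toEquiv := e.subtypeEquiv fun a => by simp [relabel_parent]
  map_rel_iff' := by
    intro a b
    simp [Forest.ChildOf, relabel_parent]

theorem autCard_relabel (t : Tree I) (e : I ≃ J) : (t.relabel e).autCard = t.autCard := by
  refine Nat.card_congr (e.symm.permCongr.subtypeEquiv fun p => ?_)
  have h : t.relabel (e.symm.permCongr p) = ((t.relabel e).relabel p).relabel e.symm := by
    rw [relabel_trans, relabel_trans]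
    congr 1
  rw [h]
  constructor
  · intro h1
    rw [h1, relabel_symm_relabel]
  · intro h1
    have h2 := congrArg (fun u => u.relabel e) h1
    simp only [relabel_trans, Equiv.trans_assoc, Equiv.symm_trans_self, Equiv.trans_refl] at h2
    rw [relabel_trans, h2]

theorem autCard_ne_zero [Finite I] (t : Tree I) : t.autCard ≠ 0 := by
  have : Nonempty {e : Equiv.Perm I // t.relabel e = t} := ⟨⟨Equiv.refl _, relabel_refl t⟩⟩
  exact Nat.card_pos.ne'

theorem cls_eq_of_relabel [Finite I] [Finite J] {s : Tree I} {t : Tree J} (e : I ≃ J)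
    (h : s.relabel e = t) : s.cls = t.cls := by
  refine Quotient.sound (s := treeSetoid)
    ⟨((Finite.equivFin I).symm.trans e).trans (Finite.equivFin J), ?_⟩
  subst h
  simp only [relabel_trans]
  congr 1
  ext
  simp

theorem exists_relabel_eq_rep [Finite I] (t : Tree I) :
    ∃ e : I ≃ Fin t.cls.rep.1, t.relabel e = t.cls.rep.2 := by
  have h : Quotient.mk treeSetoid t.cls.rep = t.cls := Quotient.out_eq _
  obtain ⟨e, he⟩ := Quotient.exact h.symm
  exact ⟨(Finite.equivFin I).trans e, by rw [← relabel_trans]; exact he⟩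

theorem autCard_cls [Finite I] (t : Tree I) : t.cls.autCard = t.autCard := by
  obtain ⟨e, he⟩ := t.exists_relabel_eq_rep
  rw [UTree.autCard, ← he, autCard_relabel]

theorem nonempty_interval_cls_iso [Finite I] (t : Tree I) :
    Nonempty (t.cls.Interval ≃o ClosedSet t.toForest.ChildOf) := by
  obtain ⟨e, he⟩ := t.exists_relabel_eq_rep
  have g := ClosedSet.congr (t.relabelChildOf e)
  rw [he] at g
  exact ⟨(Forest.intervalIso _).trans g.symm⟩

section Graft

variable {k : ℕ} {V : Fin k → Type} (t : ∀ i, Tree (V i))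

/-- The non-root vertices of a grafting are the vertices of the grafted trees. -/
def graftChildOf :
    (fun a b : Σ i, V i => ((t a.1).parent a.2).map (Sigma.mk a.1) = some b) ≃r
      (graft t).toForest.ChildOf where
  toFun a := ⟨some a, by simp [graft]⟩
  invFun
    | ⟨none, h⟩ => (h rfl).elim
    | ⟨some a, _⟩ => a
  left_inv _ := rfl
  right_inv
    | ⟨none, h⟩ => (h rfl).elim
    | ⟨some _, _⟩ => rfl
  map_rel_iff' := by
    intro a b
    change some (((t a.1).parent a.2).map (Sigma.mk a.1)) = some (some b) ↔ _
    rw [Option.some_inj]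

/-- The interval of a grafting is the product of the posets of closed sets of the grafted trees. -/
theorem nonempty_interval_graft_iso [∀ i, Finite (V i)] :
    Nonempty ((graft t).cls.Interval ≃o
      ∀ i, ClosedSet fun a b : V i => (t i).parent a = some b) := by
  obtain ⟨e⟩ := (graft t).nonempty_interval_cls_iso
  refine ⟨(e.trans (ClosedSet.congr (graftChildOf t)).symm).trans
    (ClosedSet.sigmaIso (fun i (a b : V i) => (t i).parent a = some b) _ fun a b => ?_)⟩
  rw [Option.map_eq_some_iff]

end Graft

end Tree

/-! ### Products of poset classes -/

theorem PosetClass.mk_pi : ∀ {k : ℕ} (X : Fin k → Type) [∀ i, PartialOrder (X i)],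
    PosetClass.mk (∀ i, X i) = ∏ i, PosetClass.mk (X i)
  | 0, X, _ => by
    rw [Fin.prod_univ_zero]
    exact PosetClass.mk_eq (Q := PUnit)
      { toFun := fun _ => PUnit.unit
        invFun := fun _ i => i.elim0
        left_inv := fun _ => Subsingleton.elim _ _
        right_inv := fun _ => rfl
        map_rel_iff' := fun {a b} => ⟨fun _ i => i.elim0, fun _ => le_rfl⟩ }
  | k + 1, X, _ => by
    rw [Fin.prod_univ_succ, ← PosetClass.mk_pi fun i : Fin k => X i.succ]
    exact PosetClass.mk_eq (Fin.consOrderIso X).symm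

/-! ### Unlabelled trees as the basis of `H_NAP` -/

namespace UTree

/-- Each factor of the product attached to a grafting is itself the poset of a grafting with one
branch. -/
theorem mk_interval_graft {k : ℕ} {V : Fin k → Type} [∀ i, Finite (V i)] (t : ∀ i, Tree (V i)) :
    PosetClass.mk (Tree.graft t).cls.Interval =
      ∏ i, PosetClass.mk (Tree.graft fun _ : Fin 1 => t i).cls.Interval := by
  obtain ⟨e⟩ := Tree.nonempty_interval_graft_iso t
  rw [PosetClass.mk_eq e, PosetClass.mk_pi]
  refine Finset.prod_congr rfl fun i _ => ?_
  obtain ⟨e'⟩ := Tree.nonempty_interval_graft_iso fun _ : Fin 1 => t i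
  exact (PosetClass.mk_eq (e'.trans (OrderIso.funUnique (Fin 1) _))).symm

theorem rep_cls (α : UTree) : α.rep.2.cls = α := by
  refine Eq.trans ?_ (Quotient.out_eq α)
  exact Quotient.sound (s := treeSetoid) ⟨(Finite.equivFin _).symm, Tree.relabel_symm_relabel _ _⟩

/-- The poset `P_α` determines `α`. -/
theorem mk_interval_injective :
    Function.Injective fun α : UTree => PosetClass.mk α.Interval := by
  intro α β h
  obtain ⟨e⟩ : Nonempty (α.Interval ≃o β.Interval) := Quotient.exact h
  obtain ⟨g⟩ := ClosedSet.nonempty_relIso (Forest.childOf_wf _) (Forest.childOf_wf _)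
    (Forest.childOf_functional _) (Forest.childOf_functional _)
    (((Forest.intervalIso α.rep.2.toForest).symm.trans e).trans
      (Forest.intervalIso β.rep.2.toForest))
  obtain ⟨f, hf⟩ := Tree.exists_relabel_eq g
  rw [← rep_cls α, ← rep_cls β]
  exact Tree.cls_eq_of_relabel f hf

/-- Every rooted tree is a grafting of rooted trees. -/
theorem exists_eq_graft (α : UTree) :
    ∃ (k : ℕ) (u : Fin k → Σ V : {V : Type // Finite V}, Tree V.1),
      haveI := fun i => (u i).1.2
      (Tree.graft fun i => (u i).2).cls = α := by
  -- The branches are the components left after deleting the root of a representative.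
  set x : Forest α.rep.2.toForest.NonRoot := α.rep.2.toForest.deleteRoots with hx
  let σ : x.Roots ≃ Fin (Nat.card x.Roots) := Finite.equivFin _
  refine ⟨_, fun i => ⟨⟨{a // x.rootOf a = σ.symm i}, inferInstance⟩, x.component (σ.symm i)⟩, ?_⟩
  let E : (Σ i, {a // x.rootOf a = σ.symm i}) ≃ α.rep.2.toForest.NonRoot :=
    ((Equiv.sigmaCongrLeft σ.symm (β := fun r => {a // x.rootOf a = r})).trans
      (Equiv.sigmaFiberEquiv x.rootOf))
  have hE : ∀ a, E a = a.2.1 := fun a => rfl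
  let g : (Tree.graft fun i => x.component (σ.symm i)).toForest.ChildOf ≃r
      α.rep.2.toForest.ChildOf :=
    (Tree.graftChildOf fun i => x.component (σ.symm i)).symm.trans
      ⟨E, by
        intro a b
        rw [← Forest.deleteRoots_parent, ← hx, Option.map_eq_some_iff, hE, hE]
        constructor
        · intro h
          -- A vertex and its parent lie in the same component, so no parent relation joins
          -- different branches.
          have hi : a.1 = b.1 := σ.symm.injective <| by
            rw [← a.2.2, ← b.2.2, x.rootOf_parent h]
          obtain ⟨i, b⟩ := b
          obtain ⟨j, a⟩ := a
          obtain rfl : j = i := hi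
          exact ⟨b, (x.component_parent _ _ _).2 h, rfl⟩
        · rintro ⟨c, hc, rfl⟩
          exact (x.component_parent _ _ _).1 hc⟩
  obtain ⟨f, hf⟩ := Tree.exists_relabel_eq g
  exact (Tree.cls_eq_of_relabel f hf).trans (rep_cls α)

/-- The product of two posets `P_α` and `P_β` is again of this form; if a function on unlabelled
trees is multiplicative over graftings, then it is multiplicative along this product. -/
theorem exists_mul (c : UTree → ℚ)
    (hc : ∀ (k : ℕ) (V : Fin k → Type) [∀ i, Finite (V i)] (t : ∀ i, Tree (V i)),
      c (Tree.graft t).cls = ∏ i, c (Tree.graft fun _ : Fin 1 => t i).cls) (α β : UTree) :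
    ∃ γ : UTree, PosetClass.mk γ.Interval = PosetClass.mk α.Interval * PosetClass.mk β.Interval ∧
      c γ = c α * c β := by
  obtain ⟨k, u, rfl⟩ := exists_eq_graft α
  obtain ⟨l, v, rfl⟩ := exists_eq_graft β
  have := fun i => (u i).1.2
  have := fun i => (v i).1.2
  have := fun i => (Fin.append u v i).1.2
  -- Bundling the vertex type with its tree lets `congrArg` transport the equations for `Fin.append`
  -- despite the type dependency.
  let g : (Σ V : {V : Type // Finite V}, Tree V.1) → UTree := fun w =>
    haveI := w.1.2
    (Tree.graft fun _ : Fin 1 => w.2).cls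
  -- The witness merges the two roots, keeping the branches of both trees.
  refine ⟨(Tree.graft fun i => (Fin.append u v i).2).cls, ?_, ?_⟩
  · rw [mk_interval_graft, mk_interval_graft, mk_interval_graft, Fin.prod_univ_add]
    congr 1 <;> refine Finset.prod_congr rfl fun i _ => ?_
    · exact congrArg (fun w => PosetClass.mk (g w).Interval) (Fin.append_left u v i)
    · exact congrArg (fun w => PosetClass.mk (g w).Interval) (Fin.append_right u v i)
  · rw [hc, hc, hc, Fin.prod_univ_add]
    congr 1 <;> refine Finset.prod_congr rfl fun i _ => ?_
    · exact congrArg (fun w => c (g w)) (Fin.append_left u v i)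
    · exact congrArg (fun w => c (g w)) (Fin.append_right u v i)

theorem mk_interval_unit : PosetClass.mk unit.Interval = 1 :=
  congrArg Subtype.val (MonoidAlgebra.of_injective (F_unit.trans (map_one _).symm))

theorem exists_of_mem_products {p : PosetClass} (hp : p ∈ products) :
    ∃ α : UTree, PosetClass.mk α.Interval = p := by
  induction hp using Submonoid.closure_induction with
  | mem p h => exact h
  | one => exact ⟨unit, mk_interval_unit⟩
  | mul p q _ _ hp hq =>
    obtain ⟨α, rfl⟩ := hp
    obtain ⟨β, rfl⟩ := hq
    -- Only the statement on posets is needed, so the constant function `1` serves as `c`.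
    obtain ⟨γ, h, -⟩ := exists_mul (fun _ => 1) (by simp) α β
    exact ⟨γ, h⟩

theorem autCard_ne_zero (α : UTree) : (α.autCard : ℚ) ≠ 0 :=
  Nat.cast_ne_zero.2 (Tree.autCard_ne_zero _)

/-- A function on unlabelled trees which is multiplicative over graftings extends to an algebra
morphism on `H_NAP`. -/
theorem exists_algHom (c : UTree → ℚ) (h1 : c unit = 1)
    (hc : ∀ (k : ℕ) (V : Fin k → Type) [∀ i, Finite (V i)] (t : ∀ i, Tree (V i)),
      c (Tree.graft t).cls = ∏ i, c (Tree.graft fun _ : Fin 1 => t i).cls) :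
    ∃ φ : H →ₐ[ℚ] ℚ, ∀ α, φ (F α) = c α := by
  -- `τ` inverts `α ↦ [P_α]`; injectivity makes its values independent of the choice.
  choose τ hτ using fun p : products => exists_of_mem_products p.2
  have hτ' : ∀ (p : products) (α : UTree), PosetClass.mk α.Interval = p.1 → τ p = α :=
    fun p α h => mk_interval_injective ((hτ p).trans h.symm)
  let ψ : products →* ℚ :=
    { toFun := fun p => c (τ p)
      map_one' := by rw [hτ' 1 unit mk_interval_unit, h1]
      map_mul' := fun p q => by
        obtain ⟨γ, hγ, hγ'⟩ := exists_mul c hc (τ p) (τ q)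
        rw [hτ' (p * q) γ (by rw [hγ, hτ, hτ]; rfl), hγ'] }
  refine ⟨MonoidAlgebra.lift ℚ ℚ products ψ, fun α => ?_⟩
  rw [F, MonoidAlgebra.lift_of]
  exact congrArg c (hτ' _ _ rfl)

end UTree

/-! ### Multiplicativity of `F` and the characterisation of `Spec H_NAP` -/

theorem F_graft {k : ℕ} {V : Fin k → Type} [∀ i, Finite (V i)] (t : ∀ i, Tree (V i)) :
    F (Tree.graft t).cls = ∏ i, F (Tree.graft fun _ : Fin 1 => t i).cls := by
  simp only [F]
  rw [← map_prod]
  congr 1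
  apply Subtype.ext
  rw [Submonoid.coe_finsetProd]
  exact UTree.mk_interval_graft t

end NAP

theorem mainTheorem11 (f : NAP.G) :
    f ∈ NAP.specH ↔
      ∀ (k : ℕ) (V : Fin k → Type) [∀ i, Finite (V i)] (t : ∀ i, NAP.Tree (V i)),
        ((NAP.Tree.graft t).autCard : ℚ) * f.coeff (NAP.Tree.graft t).cls =
          ∏ i, ((NAP.Tree.graft fun _ : Fin 1 => t i).autCard : ℚ) *
            f.coeff (NAP.Tree.graft fun _ : Fin 1 => t i).cls := by
  constructor
  · rintro ⟨φ, rfl⟩ k V _ t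
    have h : ∀ α : NAP.UTree, (α.autCard : ℚ) * (NAP.specToG φ).coeff α = φ (NAP.F α) :=
      fun α => mul_div_cancel₀ _ α.autCard_ne_zero
    simp only [← NAP.Tree.autCard_cls, h]
    rw [NAP.F_graft, map_prod]
  · intro h
    obtain ⟨φ, hφ⟩ := NAP.UTree.exists_algHom (fun α => (α.autCard : ℚ) * f.coeff α)
      (by simp [NAP.autCard_unit, f.coeff_unit])
      (fun k V _ t => by simpa only [NAP.Tree.autCard_cls] using h k V t)
    refine ⟨φ, ?_⟩
    obtain ⟨coeff, h1⟩ := f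
    simp only [NAP.specToG, NAP.G.mk.injEq]
    funext α
    rw [hφ]
    exact mul_div_cancel_left₀ _ α.autCard_ne_zero
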